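/- Let $X$ be a compact Hausdorff space, $\Delta_1\subset X$ a clopen set and $\alpha:\Delta_1\to X$ a continuous map whose image $\Delta_{-1}=\alpha(\Delta_1)$ is open. Let $\mathcal A=C(X)$ and let $\delta:\mathcal A\to\mathcal A$ be the endomorphism with $\delta(a)(x)=a(\alpha(x))$ for $x\in\Delta_1$ and $\delta(a)(x)=0$ for $x\notin\Delta_1$. For $n\ge 0$ let $\Delta_n$ be the domain of $\alpha^n$ (so $\Delta_0=X$). Let $X\cup\{0\}$ be the disjoint union of $X$ with an isolated point $0$, and let the $\alpha$-extension of $X$ be $\widetilde X=\bigcup_{N\ge 0}X_N\cup X_\infty\subset\prod_{n\ge 0}(X\cup\{0\})$ with the topology induced by the product topology, where $$X_N=\{(x_0,\dots,x_N,0,0,\dots): x_0\in X,\ x_n\in\Delta_n,\ \alpha(x_n)=x_{n-1}\ (1\le n\le N),\ x_N\notin\Delta_{-1}\},$$ $$X_\infty=\{(x_0,x_1,\dots): x_0\in X,\ x_n\in\Delta_n,\ \alpha(x_n)=x_{n-1}\ (n\ge 1)\}.$$ Let $\widetilde\alpha(x_0,x_1,\dots)=(\alpha(x_0),x_0,x_1,\dots)$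 on $\widetilde\Delta_1=\{\widetilde x\in\widetilde X:x_0\in\Delta_1\}$, with inverse $\widetilde\alpha^{-1}(x_0,x_1,\dots)=(x_1,x_2,\dots)$ on $\widetilde\Delta_{-1}=\{\widetilde x\in\widetilde X:x_1\ne 0\}=\{\widetilde x\in\widetilde X:x_0\in\Delta_{-1}\}$. For $b\in C(\widetilde X)$ put $\widetilde\delta(b)=b\circ\widetilde\alpha$ on $\widetilde\Delta_1$ and $0$ elsewhere, and $\widetilde\delta_*(b)=b\circ\widetilde\alpha^{-1}$ on $\widetilde\Delta_{-1}$ and $0$ elsewhere. For $a_0,\dots,a_N\in\mathcal A$ let $[a_0,\dots,a_N,0,\dots]\in C(\widetilde X)$ be the function $\widetilde x=(x_0,x_1,\dots)\mapsto\sum_{n=0}^N a_n(x_n)$, where $a_n(x_n)=0$ if $x_n=0$. A covariant faithful representation of $(X,\alpha)$ is a triple $(\pi,U,H)$ in which $\pi:\mathcal A\to L(H)$ is an injective $*$-homomorphism (not necessarily unital) into the bounded operators on a complex Hilbert space $H$, and $U\in L(H)$ is a partial isometry with initial space $\pi(C_{\Delta_{-1}}(X))H$ and final space $\pi(C_{\Delta_1}(X))H$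 such that $U\pi(a)U^*=\pi(\delta(a))$ for all $a\in\mathcal A$; here $C_K(X)$ is the set of functions in $C(X)$ that vanish outside $K$, and $\pi(C_K(X))H$ denotes a closed linear span. The same definition applies to $(\widetilde X,\widetilde\alpha)$ and $\widetilde\delta$. **Theorem.** Let $(\pi,U,H)$ be a covariant faithful representation of $(X,\alpha)$, and let $C^*\big(\bigcup_{n\ge 0}U^{*n}\pi(\mathcal A)U^n\big)$ be the closed $*$-subalgebra of $L(H)$ generated by the operators $U^{*n}\pi(a)U^n$ ($n\ge0$, $a\in\mathcal A$). Then $\widetilde X$ is compact, and there is a $*$-isomorphism $$\overline\pi: C(\widetilde X)\to C^*\Big(\bigcup_{n\ge 0}U^{*n}\pi(\mathcal A)U^n\Big)$$ with $\overline\pi([a_0,\dots,a_N,0,\dots])=\sum_{n=0}^N U^{*n}\pi(a_n)U^n$ for all $N\geq 0$ and all $a_0,\dots,a_N\in\mathcal A$; it is the only $*$-isomorphism with this property. Equivalently, $\overline\pi^{-1}$ maps $\sum_{n=0}^N U^{*n}\pi(a_n)U^n$ to the function $\widetilde x\mapsto\sum_{n=0}^N a_n(x_n)$. The map $\overline\pi$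 extends $\pi$: if $\Phi(\widetilde x)=x_0$, then $\overline\pi(a\circ\Phi)=\pi(a)$ for all $a\in\mathcal A$. Moreover $(\overline\pi,U,H)$ is a covariant faithful representation of $(\widetilde X,\widetilde\alpha)$, and for all $b\in C(\widetilde X)$ $$\overline\pi(\widetilde\delta(b))=U\,\overline\pi(b)\,U^*,\qquad \overline\pi(\widetilde\delta_*(b))=U^*\,\overline\pi(b)\,U .$$ -/

import Mathlib

/-- A partial dynamical system: a continuous map `α : Δ₁ → X` defined on a clopen set `Δ₁ ⊆ X`. -/
structure PartialDynSys (X : Type*) [TopologicalSpace X] where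
  /-- the domain `Δ₁` of `α` -/
  dom : Set X
  isClopen_dom : IsClopen dom
  /-- the map `α` -/
  map : dom → X
  continuous_map : Continuous map

namespace PartialDynSys

variable {X : Type*} [TopologicalSpace X] (P : PartialDynSys X)

/-- The image `Δ₋₁ = α(Δ₁)`. -/
def image : Set X := Set.range P.map

/-- The domain `Δₙ` of the `n`-fold iterate `αⁿ`; `Δ₀ = X`. -/
def domIter : ℕ → Set X
  | 0 => Set.univ
  | n + 1 => {x | ∃ h : x ∈ P.dom, P.map ⟨x, h⟩ ∈ domIter n}

/-- `MapsTo x y`: the point `x` is in the domain of `α`, and `α(x) = y`. -/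
def MapsTo (x y : X) : Prop := ∃ h : x ∈ P.dom, P.map ⟨x, h⟩ = y

open Classical in
/-- The endomorphism `δ` of `C(X)` given by `α`: `δ(a)(x) = a(α(x))` for `x ∈ Δ₁`, and
`δ(a)(x) = 0` otherwise. -/
noncomputable def endo : C(X, ℂ) →⋆ₙₐ[ℂ] C(X, ℂ) where
  toFun a :=
    { toFun := fun x => if h : x ∈ P.dom then a (P.map ⟨x, h⟩) else 0
      continuous_toFun := by
        have h1 : ContinuousOn
            (fun x => if h : x ∈ P.dom then a (P.map ⟨x, h⟩) else 0) P.dom := by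
          rw [continuousOn_iff_continuous_domRestrict]
          exact (a.continuous.comp P.continuous_map).congr fun x => by
            simp [Set.domRestrict]
        have h2 : ContinuousOn
            (fun x => if h : x ∈ P.dom then a (P.map ⟨x, h⟩) else 0) P.domᶜ := by
          refine (continuousOn_const (c := (0 : ℂ))).congr ?_
          intro x hx
          exact dif_neg hx
        rw [← continuousOn_univ, ← Set.union_compl_self P.dom]
        exact h1.union_of_isOpen h2 P.isClopen_dom.isOpen P.isClopen_dom.compl.isOpen }
  map_smul' c a := by
    ext x; by_cases h : x ∈ P.dom <;> simp [h]
  map_zero' := by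
    ext x; simp
  map_add' a b := by
    ext x; by_cases h : x ∈ P.dom <;> simp [h]
  map_mul' a b := by
    ext x; by_cases h : x ∈ P.dom <;> simp [h]
  map_star' a := by
    ext x; by_cases h : x ∈ P.dom <;> simp [h]

/-! ### The extension of the space

The space `X ∪ {0}`, with `{0}` clopen, is the topological sum `X ⊕ Unit`; the symbol `0` is
`Sum.inr ()`. -/

/-- The set `X_N` of sequences `(x₀, …, x_N, 0, 0, …)` with `xₙ ∈ Δₙ` and `α(xₙ) = xₙ₋₁` for
`1 ≤ n ≤ N`, and with `x_N ∉ Δ₋₁`. -/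
def finiteAntiOrbits (N : ℕ) : Set (ℕ → X ⊕ Unit) :=
  {x | ∃ y : ℕ → X, (∀ n ≤ N, x n = Sum.inl (y n)) ∧ (∀ n, N < n → x n = Sum.inr ()) ∧
    (∀ n < N, y (n + 1) ∈ P.domIter (n + 1) ∧ P.MapsTo (y (n + 1)) (y n)) ∧ y N ∉ P.image}

/-- The set `X_∞` of sequences `(x₀, x₁, …)` with `xₙ ∈ Δₙ` and `α(xₙ) = xₙ₋₁` for `n ≥ 1`. -/
def infiniteAntiOrbits : Set (ℕ → X ⊕ Unit) :=
  {x | ∃ y : ℕ → X, (∀ n, x n = Sum.inl (y n)) ∧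
    (∀ n, y (n + 1) ∈ P.domIter (n + 1) ∧ P.MapsTo (y (n + 1)) (y n))}

/-- The `α`-extension of `X`: the union of all `X_N` and of `X_∞`, with the topology inherited
from the product of countably many copies of `X ∪ {0}`. -/
def Ext : Type _ :=
  {x : ℕ → X ⊕ Unit // x ∈ (⋃ N, P.finiteAntiOrbits N) ∪ P.infiniteAntiOrbits}

instance : TopologicalSpace P.Ext := inferInstanceAs (TopologicalSpace (Subtype _))

theorem continuous_coord (n : ℕ) : Continuous fun x : P.Ext => x.1 n :=
  (continuous_apply n).comp continuous_subtype_val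

theorem exists_coord_zero (x : P.Ext) : ∃ z : X, x.1 0 = Sum.inl z := by
  obtain ⟨x, hx⟩ := x
  rcases hx with hx | ⟨y, h, -⟩
  · obtain ⟨N, y, h, -⟩ := Set.mem_iUnion.1 hx
    exact ⟨y 0, h 0 (Nat.zero_le _)⟩
  · exact ⟨y 0, h 0⟩

/-- The projection `Φ(x₀, x₁, …) = x₀`. -/
noncomputable def proj : C(P.Ext, X) where
  toFun x := (P.exists_coord_zero x).choose
  continuous_toFun := by
    rw [Topology.IsEmbedding.inl (X := X) (Y := Unit) |>.continuous_iff]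
    have : (Sum.inl ∘ fun x : P.Ext => (P.exists_coord_zero x).choose : P.Ext → X ⊕ Unit)
        = fun x => x.1 0 := by
      funext x
      exact (P.exists_coord_zero x).choose_spec.symm
    rw [this]
    exact P.continuous_coord 0

theorem coord_zero (x : P.Ext) : x.1 0 = Sum.inl (P.proj x) :=
  (P.exists_coord_zero x).choose_spec

/-- The sequence `(z, x₀, x₁, …)`. -/
def consSeq {Y : Type*} (z : Y) (x : ℕ → Y) : ℕ → Y
  | 0 => z
  | n + 1 => x n

theorem domIter_succ_subset (n : ℕ) : P.domIter (n + 1) ⊆ P.domIter n := by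
  induction n with
  | zero => intro x _; trivial
  | succ n ih => rintro x ⟨h, h'⟩; exact ⟨h, ih h'⟩

theorem consSeq_mem (x : P.Ext) (h : P.proj x ∈ P.dom) :
    consSeq (Sum.inl (P.map ⟨P.proj x, h⟩)) x.1 ∈
      (⋃ N, P.finiteAntiOrbits N) ∪ P.infiniteAntiOrbits := by
  have h0 := P.coord_zero x
  rcases x.2 with hx | ⟨y, hy, hm⟩
  · obtain ⟨N, y, hy, hy', hm, hN⟩ := Set.mem_iUnion.1 hx
    have hz : P.proj x = y 0 := Sum.inl.inj (h0.symm.trans (hy 0 (Nat.zero_le _)))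
    have key : ∀ n ≤ N, y n ∈ P.domIter (n + 1) := by
      intro n
      induction n with
      | zero => intro _; exact ⟨hz ▸ h, trivial⟩
      | succ n ih =>
        intro hn
        obtain ⟨-, hd, he⟩ := hm n (by omega)
        exact ⟨hd, he ▸ ih (by omega)⟩
    refine Or.inl (Set.mem_iUnion.2 ⟨N + 1, consSeq (P.map ⟨P.proj x, h⟩) y, ?_, ?_, ?_, hN⟩)
    · rintro (_ | n) hn
      · rfl
      · exact hy n (by omega)
    · rintro (_ | n) hn
      · omega
      · exact hy' n (by omega)
    · rintro (_ | n) hn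
      · exact ⟨key 0 (by omega), (show y 0 ∈ P.dom from hz ▸ h),
          congrArg P.map (Subtype.ext hz.symm)⟩
      · exact ⟨key (n + 1) (by omega), (hm n (by omega)).2⟩
  · have hz : P.proj x = y 0 := Sum.inl.inj (h0.symm.trans (hy 0))
    have key : ∀ n, y n ∈ P.domIter (n + 1) := by
      intro n
      induction n with
      | zero => exact ⟨hz ▸ h, trivial⟩
      | succ n ih =>
        obtain ⟨-, hd, he⟩ := hm n
        exact ⟨hd, he ▸ ih⟩
    refine Or.inr ⟨consSeq (P.map ⟨P.proj x, h⟩) y, ?_, ?_⟩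
    · rintro (_ | n)
      · rfl
      · exact hy n
    · rintro (_ | n)
      · exact ⟨key 0, (show y 0 ∈ P.dom from hz ▸ h),
          congrArg P.map (Subtype.ext hz.symm)⟩
      · exact ⟨key (n + 1), (hm n).2⟩

/-- The partial mapping `α̃(x₀, x₁, …) = (α(x₀), x₀, x₁, …)` of the extension, with domain
`Δ̃₁ = {x₀ ∈ Δ₁}`. -/
noncomputable def rev : PartialDynSys P.Ext where
  dom := P.proj ⁻¹' P.dom
  isClopen_dom := P.isClopen_dom.preimage P.proj.continuous
  map x := ⟨consSeq (Sum.inl (P.map ⟨P.proj x.1, x.2⟩)) x.1.1, P.consSeq_mem x.1 x.2⟩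
  continuous_map := by
    refine Continuous.subtype_mk (continuous_pi ?_) _
    rintro (_ | n)
    · exact continuous_inl.comp (P.continuous_map.comp
        ((P.proj.continuous.comp continuous_subtype_val).subtype_mk _))
    · exact (P.continuous_coord n).comp continuous_subtype_val

theorem shift_mem (x : P.Ext) (h : x.1 1 ≠ Sum.inr ()) :
    (fun n => x.1 (n + 1)) ∈ (⋃ N, P.finiteAntiOrbits N) ∪ P.infiniteAntiOrbits := by
  rcases x.2 with hx | ⟨y, hy, hm⟩
  · obtain ⟨N, y, hy, hy', hm, hN⟩ := Set.mem_iUnion.1 hx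
    obtain _ | N := N
    · exact absurd (hy' 1 Nat.zero_lt_one) h
    refine Or.inl (Set.mem_iUnion.2 ⟨N, fun n => y (n + 1), ?_, ?_, ?_, hN⟩)
    · exact fun n hn => hy (n + 1) (by omega)
    · exact fun n hn => hy' (n + 1) (by omega)
    · exact fun n hn => ⟨P.domIter_succ_subset _ (hm (n + 1) (by omega)).1,
        (hm (n + 1) (by omega)).2⟩
  · exact Or.inr ⟨fun n => y (n + 1), fun n => hy (n + 1), fun n =>
      ⟨P.domIter_succ_subset _ (hm (n + 1)).1, (hm (n + 1)).2⟩⟩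

/-- The inverse `α̃⁻¹(x₀, x₁, …) = (x₁, x₂, …)` of `α̃`, with domain `Δ̃₋₁ = {x₁ ≠ 0}`; that this
is the inverse of `rev` is shown in the theorems that follow. -/
def revInv : PartialDynSys P.Ext where
  dom := {x | x.1 1 ≠ Sum.inr ()}
  isClopen_dom := by
    have h : IsClopen ({Sum.inr ()}ᶜ : Set (X ⊕ Unit)) := by
      have : ({Sum.inr ()} : Set (X ⊕ Unit)) = Set.range Sum.inr := by
        ext z; rcases z with z | ⟨⟩ <;> simp
      rw [this]
      exact (isClopen_range_inr).compl
    exact h.preimage (P.continuous_coord 1)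
  map x := ⟨fun n => x.1.1 (n + 1), P.shift_mem x.1 x.2⟩
  continuous_map :=
    Continuous.subtype_mk (continuous_pi fun n =>
      (P.continuous_coord (n + 1)).comp continuous_subtype_val) _

theorem revInv_dom : P.revInv.dom = P.proj ⁻¹' P.image := by
  ext x
  have h0 := P.coord_zero x
  rcases x.2 with hx | ⟨y, hy, hm⟩
  · obtain ⟨N, y, hy, hy', hm, hN⟩ := Set.mem_iUnion.1 hx
    have hz : P.proj x = y 0 := Sum.inl.inj (h0.symm.trans (hy 0 (Nat.zero_le _)))
    constructor
    · intro h
      obtain _ | N := N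
      · exact absurd (hy' 1 Nat.zero_lt_one) h
      · obtain ⟨-, hd, he⟩ := hm 0 (by omega)
        exact ⟨_, he.trans hz.symm⟩
    · intro h h1
      obtain _ | N := N
      · exact hN (hz ▸ h)
      · rw [hy 1 (by omega)] at h1
        exact absurd h1 (by simp)
  · have hz : P.proj x = y 0 := Sum.inl.inj (h0.symm.trans (hy 0))
    constructor
    · intro _
      obtain ⟨-, hd, he⟩ := hm 0
      exact ⟨_, he.trans hz.symm⟩
    · intro _ h1
      rw [hy 1] at h1
      exact absurd h1 (by simp)

theorem rev_mapsTo_iff (x y : P.Ext) : P.rev.MapsTo x y ↔ P.revInv.MapsTo y x := by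
  constructor
  · rintro ⟨h, rfl⟩
    have h1 : (P.rev.map ⟨x, h⟩).1 1 = Sum.inl (P.proj x) := P.coord_zero x
    exact ⟨by change _ ≠ _; rw [h1]; simp, rfl⟩
  · rintro ⟨h, rfl⟩
    have key : P.MapsTo (P.proj (P.revInv.map ⟨y, h⟩)) (P.proj y) := by
      have h0 := P.coord_zero y
      have h1 : y.1 1 = Sum.inl _ := P.coord_zero (P.revInv.map ⟨y, h⟩)
      rcases y.2 with hx | ⟨z, hy, hm⟩
      · obtain ⟨N, z, hy, hy', hm, hN⟩ := Set.mem_iUnion.1 hx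
        obtain _ | N := N
        · exact absurd (hy' 1 Nat.zero_lt_one) h
        rw [hy 0 (by omega)] at h0
        rw [hy 1 (by omega)] at h1
        rw [← Sum.inl.inj h0, ← Sum.inl.inj h1]
        exact (hm 0 (by omega)).2
      · rw [hy 0] at h0
        rw [hy 1] at h1
        rw [← Sum.inl.inj h0, ← Sum.inl.inj h1]
        exact (hm 0).2
    obtain ⟨hd, he⟩ := key
    refine ⟨hd, Subtype.ext (funext ?_)⟩
    rintro (_ | n)
    · exact (congrArg Sum.inl he).trans (P.coord_zero y).symm
    · rfl

/-- The element `[a₀, …, a_N, 0, …]` of `C(X̃)`, that is the function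
`(x₀, x₁, …) ↦ ∑ aₙ(xₙ)` (sum over `0 ≤ n ≤ N`), where `aₙ(xₙ) = 0` if `xₙ = 0`. -/
noncomputable def bracket (N : ℕ) (a : ℕ → C(X, ℂ)) : C(P.Ext, ℂ) where
  toFun x := ∑ n ∈ Finset.range (N + 1), Sum.elim (a n) (fun _ => 0) (x.1 n)
  continuous_toFun := continuous_finsetSum _ fun n _ =>
    ((a n).continuous.sumElim continuous_const).comp (P.continuous_coord n)

/-! ### Covariant representations -/

/-- The ideal `C_K(X)` of functions that vanish outside `K`. -/
def vanishingOutside (K : Set X) : Set C(X, ℂ) := {a | ∀ x ∉ K, a x = 0}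

end PartialDynSys

section Rep

variable {X : Type*} [TopologicalSpace X]
  {H : Type*} [NormedAddCommGroup H] [InnerProductSpace ℂ H] [CompleteSpace H]

/-- The subspace `π(S)H`: the closed linear span of all `π(a)h`, `a ∈ S`, `h ∈ H`. -/
noncomputable def essSpace (π : C(X, ℂ) →⋆ₙₐ[ℂ] (H →L[ℂ] H)) (S : Set C(X, ℂ)) :
    Submodule ℂ H :=
  (Submodule.span ℂ {v | ∃ a ∈ S, ∃ h : H, v = π a h}).topologicalClosure

/-- `U` is a partial isometry with initial space `I` and final space `F`: it is isometric on
`I = (ker U)ᗮ`, and `F` is its range. -/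
def IsPartialIsometry (U : H →L[ℂ] H) (I F : Submodule ℂ H) : Prop :=
  (∀ h ∈ I, ‖U h‖ = ‖h‖) ∧ U.kerᗮ = I ∧ U.range = F

/-- `(π, U, H)` is a covariant representation of the partial dynamical system `P`. -/
structure IsCovRep (P : PartialDynSys X) (π : C(X, ℂ) →⋆ₙₐ[ℂ] (H →L[ℂ] H))
    (U : H →L[ℂ] H) : Prop where
  isPartialIsometry : IsPartialIsometry U
    (essSpace π (PartialDynSys.vanishingOutside P.image))
    (essSpace π (PartialDynSys.vanishingOutside P.dom))
  covariant : ∀ a : C(X, ℂ), U * π a * star U = π (P.endo a)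

/-- `(π, U, H)` is a covariant faithful representation of `P`. -/
structure IsCovFaithRep (P : PartialDynSys X) (π : C(X, ℂ) →⋆ₙₐ[ℂ] (H →L[ℂ] H))
    (U : H →L[ℂ] H) : Prop extends IsCovRep P π U where
  faithful : Function.Injective π

/-- The coefficient algebra: the smallest norm-closed `*`-subalgebra of `L(H)` that contains all
the sets `U*ⁿ π(C(X)) Uⁿ`, `n ≥ 0`. -/
noncomputable def coefAlgebra (π : C(X, ℂ) →⋆ₙₐ[ℂ] (H →L[ℂ] H)) (U : H →L[ℂ] H) :
    NonUnitalStarSubalgebra ℂ (H →L[ℂ] H) :=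
  (NonUnitalStarAlgebra.adjoin ℂ
    (⋃ n : ℕ, Set.range fun a : C(X, ℂ) => star U ^ n * π a * U ^ n)).topologicalClosure

end Rep

/-! Both `C(X̃)` and `L(H)` contain a copy `j` of `C(X)` and a pair of maps `σ`, `τ`: in `C(X̃)`
these are composition with `α̃` and with `α̃⁻¹`, extended by zero; in `L(H)` they are `U(·)U*` and
`U*(·)U`. In Horner form, `[a₀, …, a_N, 0, …]` and `∑ U*ⁿπ(aₙ)Uⁿ` are the same expression `j(a₀) +
τ(j(a₁) + τ(⋯))` in the two models. It remains to show that the two readings of each such expression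
have the same norm.

The norm is governed by a recursion valid in both models (`IsCovariantPair`): with `q` the indicator
of `Δ₋₁`, `v = j(a) + τ(w)` satisfies `‖v‖ = max ‖j(a - aq)‖ ‖σ(v)‖`. In `C(X̃)` this splits the
supremum between the points outside and inside `Δ̃₋₁`; in `L(H)` it is the block decomposition of an
operator that commutes with `U*U`. Since `σ(v)` is an expression with one level fewer, induction
reduces to `j` itself, which is isometric in both models: because `Φ` is onto in the first, because
`π` is injective in the second (`norm_eq_of_mem_stage`).

The pairs of readings form a `*`-subalgebra of `C(X̃) × L(H)`. By Stone–Weierstrass its first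
coordinates are dense, so its closure is the graph of an isometric `*`-homomorphism
(`exists_isometric_starHom_of_graph`). The range and intertwining statements extend from the dense
expressions by continuity. -/

namespace PartialDynSys

/-! ### Compactness of the extension and surjectivity of `Φ` -/

variable {X : Type*} [TopologicalSpace X] (P : PartialDynSys X)

/-- Consecutive terms of a sequence in the extension: either `v` is a point with `α(v) = u`, or
`v = 0` and `u` has no preimage under `α`. -/
def Step (u v : X ⊕ Unit) : Prop :=
  (∃ d : P.dom, u = Sum.inl (P.map d) ∧ v = Sum.inl d.1) ∨
    (v = Sum.inr () ∧ ∀ z, u = Sum.inl z → z ∉ P.image)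

/-- Once `x₀` is a point, the conditions `xₙ ∈ Δₙ` follow by induction from `α(xₙ) = xₙ₋₁`, and a
zero is followed only by zeros. Membership thus becomes a condition on neighbouring coordinates,
from which closedness can be read off. -/
theorem mem_ext_iff (x : ℕ → X ⊕ Unit) :
    x ∈ (⋃ N, P.finiteAntiOrbits N) ∪ P.infiniteAntiOrbits ↔
      (∃ z, x 0 = Sum.inl z) ∧ ∀ n, P.Step (x n) (x (n + 1)) := by
  classical
  constructor
  · rintro (hx | ⟨y, hy, hm⟩)
    · obtain ⟨N, y, hy, hy', hm, hN⟩ := Set.mem_iUnion.1 hx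
      refine ⟨⟨y 0, hy 0 (Nat.zero_le _)⟩, fun n => ?_⟩
      rcases lt_trichotomy n N with h | rfl | h
      · obtain ⟨-, hd, he⟩ := hm n h
        exact Or.inl ⟨⟨_, hd⟩, by rw [hy n h.le, he], hy (n + 1) h⟩
      · refine Or.inr ⟨hy' _ n.lt_succ_self, fun z hz => ?_⟩
        rw [hy n le_rfl] at hz
        exact Sum.inl.inj hz ▸ hN
      · refine Or.inr ⟨hy' _ (by omega), fun z hz => ?_⟩
        rw [hy' n h] at hz
        cases hz
    · refine ⟨⟨y 0, hy 0⟩, fun n => ?_⟩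
      obtain ⟨-, hd, he⟩ := hm n
      exact Or.inl ⟨⟨_, hd⟩, by rw [hy n, he], hy (n + 1)⟩
  · rintro ⟨⟨z, hz⟩, hs⟩
    have point : ∀ n, x n ≠ Sum.inr () → x n = Sum.inl ((x n).elim id fun _ => z) := by
      intro n hn
      rcases h : x n with w | ⟨⟩
      · rfl
      · exact absurd h hn
    have step : ∀ n, x (n + 1) ≠ Sum.inr () → x n ≠ Sum.inr () ∧
        P.MapsTo ((x (n + 1)).elim id fun _ => z) ((x n).elim id fun _ => z) := by
      intro n hn
      rcases hs n with ⟨d, hd, hd'⟩ | ⟨h, -⟩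
      · rw [hd, hd']
        exact ⟨by simp, d.2, rfl⟩
      · exact absurd h hn
    have iter : ∀ n, x n ≠ Sum.inr () → ((x n).elim id fun _ => z) ∈ P.domIter n := by
      intro n
      induction n with
      | zero => exact fun _ => trivial
      | succ n ih =>
        intro hn
        obtain ⟨h, hd, he⟩ := step n hn
        exact ⟨hd, he ▸ ih h⟩
    by_cases h : ∃ n, x n = Sum.inr ()
    -- The first zero cannot occur at index 0, since `x₀` is a point; `N` is the index just before
    -- it.
    · obtain ⟨N, hN⟩ : ∃ N, Nat.find h = N + 1 := by
        refine Nat.exists_eq_succ_of_ne_zero fun h0 => ?_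
        have := Nat.find_spec h
        rw [h0, hz] at this
        cases this
      have hlt : ∀ n ≤ N, x n ≠ Sum.inr () := fun n hn => Nat.find_min h (by omega)
      have hge : ∀ n, N < n → x n = Sum.inr () := by
        intro n hn
        induction n, hn using Nat.le_induction with
        | base => simpa [hN] using Nat.find_spec h
        | succ n _ ih =>
          by_contra hn
          exact (step n hn).1 ih
      refine Or.inl (Set.mem_iUnion.2 ⟨N, fun n => (x n).elim id fun _ => z,
        fun n hn => point n (hlt n hn), hge,
        fun n hn => ⟨iter _ (hlt _ hn), (step n (hlt _ hn)).2⟩, ?_⟩)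
      rcases hs N with ⟨d, -, hd⟩ | ⟨-, hd⟩
      · rw [hge (N + 1) (by omega)] at hd
        cases hd
      · exact hd _ (point N (hlt N le_rfl))
    · push Not at h
      exact Or.inr ⟨fun n => (x n).elim id fun _ => z, fun n => point n (h n),
        fun n => ⟨iter _ (h _), (step n (h _)).2⟩⟩

instance [T2Space X] : T2Space P.Ext := inferInstanceAs (T2Space (Subtype _))

/-- The first alternative is a continuous image of the compact set `Δ₁`. The second is closed
because `Δ₋₁` is open, so a point without preimage cannot be approximated by points that have one.
-/
theorem isClosed_step [CompactSpace X] [T2Space X] (hP : IsOpen P.image) :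
    IsClosed {p : (X ⊕ Unit) × (X ⊕ Unit) | P.Step p.1 p.2} := by
  have : CompactSpace P.dom := isCompact_iff_compactSpace.1 P.isClopen_dom.isClosed.isCompact
  have h1 : IsClosed (Set.range fun d : P.dom =>
      ((Sum.inl (P.map d), Sum.inl d.1) : (X ⊕ Unit) × (X ⊕ Unit))) :=
    (isCompact_range ((continuous_inl.comp P.continuous_map).prodMk
      (continuous_inl.comp continuous_subtype_val))).isClosed
  have h2 : IsClosed ((Sum.inl '' P.image)ᶜ ×ˢ {Sum.inr ()} : Set ((X ⊕ Unit) × (X ⊕ Unit))) :=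
    (isOpenMap_inl _ hP).isClosed_compl.prod isClosed_singleton
  convert h1.union h2 using 1
  ext ⟨u, v⟩
  simp only [Step, Set.mem_ofPred_eq, Set.mem_union, Set.mem_range, Prod.mk.injEq, Set.mem_prod,
    Set.mem_compl_iff, Set.mem_image, Set.mem_singleton_iff, not_exists, not_and]
  refine or_congr (exists_congr fun d => and_congr eq_comm eq_comm) ?_
  rw [and_comm]
  exact and_congr_left fun _ => ⟨fun h z hz e => h z e.symm hz, fun h z e hz => h z hz e.symm⟩

theorem compactSpace_ext [CompactSpace X] [T2Space X] (hP : IsOpen P.image) :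
    CompactSpace P.Ext := by
  refine isCompact_iff_compactSpace.1 (IsClosed.isCompact ?_)
  have : ((⋃ N, P.finiteAntiOrbits N) ∪ P.infiniteAntiOrbits) =
      (fun x : ℕ → X ⊕ Unit => x 0) ⁻¹' Set.range Sum.inl ∩
        ⋂ n, (fun x : ℕ → X ⊕ Unit => (x n, x (n + 1))) ⁻¹' {p | P.Step p.1 p.2} := by
    ext x
    rw [P.mem_ext_iff]
    simp [eq_comm]
  rw [this]
  exact (isClosed_range_inl.preimage (continuous_apply 0)).inter
    (isClosed_iInter fun n => (P.isClosed_step hP).preimage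
      ((continuous_apply n).prodMk (continuous_apply (n + 1))))

/-- Every point or zero has an admissible successor, so a backward orbit can be built from any
starting point by iterating a choice of successors. -/
theorem proj_surjective : Function.Surjective P.proj := by
  intro z
  have h : ∀ u, ∃ v, P.Step u v := by
    intro u
    by_cases hu : ∃ w ∈ P.image, u = Sum.inl w
    · obtain ⟨_, ⟨d, rfl⟩, rfl⟩ := hu
      exact ⟨Sum.inl d.1, Or.inl ⟨d, rfl, rfl⟩⟩
    · exact ⟨Sum.inr (), Or.inr ⟨rfl, fun w hw hi => hu ⟨w, hi, hw⟩⟩⟩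
  choose f hf using h
  let x : P.Ext := ⟨fun n => f^[n] (Sum.inl z), (P.mem_ext_iff _).2 ⟨⟨z, rfl⟩, fun n => by
    rw [Function.iterate_succ_apply']; exact hf _⟩⟩
  exact ⟨x, Sum.inl.inj (P.coord_zero x).symm⟩

theorem rev_image : P.rev.image = P.revInv.dom := by
  ext y
  constructor
  · rintro ⟨d, rfl⟩
    exact ((P.rev_mapsTo_iff _ _).1 ⟨d.2, rfl⟩).1
  · intro h
    obtain ⟨hd, he⟩ := (P.rev_mapsTo_iff _ y).2 ⟨h, rfl⟩
    exact ⟨_, he⟩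

theorem isClopen_image [CompactSpace X] [T2Space X] (hP : IsOpen P.image) : IsClopen P.image := by
  have : CompactSpace P.dom := isCompact_iff_compactSpace.1 P.isClopen_dom.isClosed.isCompact
  exact ⟨(isCompact_range P.continuous_map).isClosed, hP⟩

end PartialDynSys

/-! ### Clopen indicators, their range projections, and partial isometries -/

/-- The indicator function of a clopen set. -/
noncomputable def clopenIndicator {X : Type*} [TopologicalSpace X] {K : Set X} (hK : IsClopen K) :
    C(X, ℂ) :=
  (LocallyConstant.charFn ℂ hK : C(X, ℂ))

section Indicator

variable {X : Type*} [TopologicalSpace X] {K : Set X} (hK : IsClopen K)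

theorem clopenIndicator_of_mem {x : X} (hx : x ∈ K) : clopenIndicator hK x = 1 := by
  simp [clopenIndicator, LocallyConstant.coe_charFn, hx]

theorem clopenIndicator_of_notMem {x : X} (hx : x ∉ K) : clopenIndicator hK x = 0 := by
  simp [clopenIndicator, LocallyConstant.coe_charFn, hx]

theorem star_clopenIndicator : star (clopenIndicator hK) = clopenIndicator hK := by
  ext x
  by_cases hx : x ∈ K <;> simp [clopenIndicator_of_mem, clopenIndicator_of_notMem, hx]

theorem clopenIndicator_mul_self : clopenIndicator hK * clopenIndicator hK = clopenIndicator hK := by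
  ext x
  by_cases hx : x ∈ K <;> simp [clopenIndicator_of_mem, clopenIndicator_of_notMem, hx]

theorem clopenIndicator_mul_of_mem_vanishingOutside {a : C(X, ℂ)}
    (ha : a ∈ PartialDynSys.vanishingOutside K) : clopenIndicator hK * a = a := by
  ext x
  by_cases hx : x ∈ K
  · simp [clopenIndicator_of_mem, hx]
  · simp [clopenIndicator_of_notMem, hx, ha x hx]

variable {H : Type*} [NormedAddCommGroup H] [InnerProductSpace ℂ H] [CompleteSpace H]

/-- The indicator is a unit for the ideal of functions vanishing outside `K`, and the range of its
image, a projection, is already closed. This turns the conditions on initial and final spaces into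
identities between projections. -/
theorem essSpace_vanishingOutside (π : C(X, ℂ) →⋆ₙₐ[ℂ] (H →L[ℂ] H)) :
    essSpace π (PartialDynSys.vanishingOutside K) = (π (clopenIndicator hK)).range := by
  set p := π (clopenIndicator hK) with hp
  have hpp : p * p = p := by rw [hp, ← map_mul, clopenIndicator_mul_self]
  have hcl : IsClosed (p.range : Set H) := by
    have : (p.range : Set H) = {v | p v = v} := by
      ext v
      constructor
      · rintro ⟨w, rfl⟩
        exact congrArg (fun T : H →L[ℂ] H => T w) hpp
      · exact fun h => ⟨v, h⟩
    rw [this]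
    exact isClosed_eq p.continuous continuous_id
  apply le_antisymm
  · refine Submodule.topologicalClosure_minimal _ (Submodule.span_le.2 ?_) hcl
    rintro _ ⟨a, ha, h, rfl⟩
    refine ⟨π a h, ?_⟩
    change (p * π a) h = π a h
    rw [hp, ← map_mul, clopenIndicator_mul_of_mem_vanishingOutside hK ha]
  · rintro _ ⟨w, rfl⟩
    exact Submodule.le_topologicalClosure _ (Submodule.subset_span
      ⟨_, fun x hx => clopenIndicator_of_notMem hK hx, w, rfl⟩)

end Indicator

section PartialIsometry

variable {H : Type*} [NormedAddCommGroup H] [InnerProductSpace ℂ H] [CompleteSpace H]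
  {U p q : H →L[ℂ] H}

/-- As `ker U` is closed, it is the orthogonal complement of `ran p`, so `Up = U`. Then `⟨U*Uv, v⟩ =
‖Upv‖² = ‖pv‖² = ⟨pv, v⟩`, and over `ℂ` the quadratic form determines the operator. -/
theorem IsPartialIsometry.star_mul_self (hU : IsPartialIsometry U p.range q.range)
    (hp : IsStarProjection p) : star U * U = p := by
  obtain ⟨hn, hk, -⟩ := hU
  have hpp : ∀ v, p (p v) = p v := fun v =>
    congrArg (fun T : H →L[ℂ] H => T v) hp.isIdempotentElem
  have hinner : ∀ v w, inner ℂ (p v) w = inner ℂ v (p w) := fun v w => by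
    conv_lhs => rw [← hp.isSelfAdjoint.star_eq, ContinuousLinearMap.star_eq_adjoint,
      ContinuousLinearMap.adjoint_inner_left]
  have hUp : ∀ v, U (p v) = U v := by
    intro v
    have : v - p v ∈ U.ker := by
      have : IsClosed (U.ker : Set H) := U.isClosed_ker
      have : CompleteSpace U.ker := this.completeSpace_coe
      rw [← Submodule.orthogonal_orthogonal U.ker, hk, Submodule.mem_orthogonal]
      rintro _ ⟨w, rfl⟩
      change inner ℂ (p w) _ = 0
      rw [hinner, map_sub, hpp, sub_self, inner_zero_right]
    have : U (v - p v) = 0 := this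
    rw [map_sub, sub_eq_zero] at this
    exact this.symm
  refine ContinuousLinearMap.coe_injective ((ext_inner_map _ _).1 fun v => ?_)
  change inner ℂ ((star U * U) v) v = inner ℂ (p v) v
  rw [mul_apply_eq_comp, ContinuousLinearMap.star_eq_adjoint,
    ContinuousLinearMap.adjoint_inner_left, ← hpp v, hinner (p v) v, inner_self_eq_norm_sq_to_K,
    inner_self_eq_norm_sq_to_K, ← hUp v]
  rw [show ‖U (p v)‖ = ‖p v‖ from hn _ ⟨v, rfl⟩]

/-- With `D = UU*U - U`, the product `D*D` vanishes because `U*U` is idempotent. -/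
theorem IsPartialIsometry.mul_star_mul (hU : IsPartialIsometry U p.range q.range)
    (hp : IsStarProjection p) : U * star U * U = U := by
  have h := hU.star_mul_self hp
  have : star (U * star U * U - U) * (U * star U * U - U) = 0 := by
    have h3 : star U * U * (star U * U) = star U * U := by rw [h]; exact hp.isIdempotentElem
    simp only [star_sub, star_mul, star_star, sub_mul, mul_sub, ← mul_assoc] at h3 ⊢
    simp only [h3, sub_self]
  exact sub_eq_zero.1 (CStarRing.star_mul_self_eq_zero_iff _ |>.1 this)

/-- `UU*` fixes `ran U = ran q`, so `UU*q = q`; and `qU = U` gives `U*q = U*`. -/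
theorem IsPartialIsometry.self_mul_star (hU : IsPartialIsometry U p.range q.range)
    (hp : IsStarProjection p) (hq : IsStarProjection q) : U * star U = q := by
  have h1 : q * U = U := by
    ext v
    obtain ⟨w, hw⟩ : U v ∈ q.range := hU.2.2 ▸ ⟨v, rfl⟩
    have hw : q w = U v := hw
    rw [mul_apply_eq_comp, ← hw]
    exact congrArg (fun T : H →L[ℂ] H => T w) hq.isIdempotentElem
  have h2 : U * star U * q = q := by
    ext v
    obtain ⟨w, hw⟩ : q v ∈ U.range := hU.2.2 ▸ ⟨v, rfl⟩
    have hw : U w = q v := hw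
    rw [mul_apply_eq_comp, ← hw]
    exact congrArg (fun T : H →L[ℂ] H => T w) (hU.mul_star_mul hp)
  have h3 : star U * q = star U := by
    simpa [hq.isSelfAdjoint.star_eq] using congrArg star h1
  rw [← h2, mul_assoc, h3]

end PartialIsometry

theorem isStarProjection_map_clopenIndicator {X : Type*} [TopologicalSpace X] {K : Set X}
    (hK : IsClopen K) {B : Type*} [NonUnitalSemiring B] [Module ℂ B] [Star B]
    (π : C(X, ℂ) →⋆ₙₐ[ℂ] B) : IsStarProjection (π (clopenIndicator hK)) where
  isIdempotentElem := by rw [IsIdempotentElem, ← map_mul, clopenIndicator_mul_self]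
  isSelfAdjoint := by rw [IsSelfAdjoint, ← map_star, star_clopenIndicator]

/-! ### Covariant pairs and the norm recursion on stages -/

/-- A `*`-algebra `B` with a copy `j` of `C(X)` and linear maps `σ`, `τ` that behave like
`U(·)U*` and `U*(·)U` for a covariant representation with range projections `j(p) = UU*` and
`j(q) = U*U`. -/
structure IsCovariantPair {X : Type*} [TopologicalSpace X] (P : PartialDynSys X) (p q : C(X, ℂ))
    {B : Type*} [NormedRing B] [NormedAlgebra ℂ B] [StarRing B]
    (j : C(X, ℂ) →⋆ₙₐ[ℂ] B) (σ τ : B →ₗ[ℂ] B) : Prop where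
  star_comm (v : B) : τ (star v) = star (τ v)
  compress (a : C(X, ℂ)) : σ (j a) = j (P.endo a)
  mul_map (b : C(X, ℂ)) (v : B) : j b * τ v = τ (j (P.endo b) * v)
  map_mul_map (v w : B) : τ v * τ w = τ (v * j p * w)
  compress_map (v : B) : σ (τ v) = j p * v * j p
  map_mul_proj (v : B) : τ v * j q = τ v
  norm_eq (a : C(X, ℂ)) (w : B) :
    ‖j a + τ w‖ = max ‖j (a - a * q)‖ ‖σ (j a + τ w)‖

/-- The elements `j(a₀) + τ(j(a₁)) + ⋯ + τⁿ(j(aₙ))`. -/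
def stage {X B : Type*} [TopologicalSpace X] [Ring B] [StarRing B] [Algebra ℂ B]
    (j : C(X, ℂ) →⋆ₙₐ[ℂ] B) (τ : B →ₗ[ℂ] B) : ℕ → Set B
  | 0 => Set.range j
  | n + 1 => {v | ∃ a, ∃ w ∈ stage j τ n, v = j a + τ w}

section Stage

variable {X B : Type*} [TopologicalSpace X] [Ring B] [StarRing B] [Algebra ℂ B]
    (j : C(X, ℂ) →⋆ₙₐ[ℂ] B) (τ : B →ₗ[ℂ] B)

theorem map_mem_stage (n : ℕ) (a : C(X, ℂ)) : j a ∈ stage j τ n := by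
  induction n generalizing a with
  | zero => exact ⟨a, rfl⟩
  | succ n ih => exact ⟨a, j 0, ih 0, by simp⟩

theorem stage_subset_succ (n : ℕ) : stage j τ n ⊆ stage j τ (n + 1) := by
  induction n with
  | zero =>
    rintro _ ⟨a, rfl⟩
    exact map_mem_stage j τ 1 a
  | succ n ih =>
    rintro _ ⟨a, w, hw, rfl⟩
    exact ⟨a, w, ih hw, rfl⟩

theorem stage_mono : Monotone (stage j τ) := monotone_nat_of_le_succ (stage_subset_succ j τ)

theorem add_mem_stage (n : ℕ) {v w : B} (hv : v ∈ stage j τ n) (hw : w ∈ stage j τ n) :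
    v + w ∈ stage j τ n := by
  induction n generalizing v w with
  | zero =>
    obtain ⟨a, rfl⟩ := hv
    obtain ⟨b, rfl⟩ := hw
    exact ⟨a + b, map_add j a b⟩
  | succ n ih =>
    obtain ⟨a, v, hv, rfl⟩ := hv
    obtain ⟨b, w, hw, rfl⟩ := hw
    exact ⟨a + b, v + w, ih hv hw, by rw [map_add, map_add]; abel⟩

theorem smul_mem_stage (n : ℕ) (c : ℂ) {v : B} (hv : v ∈ stage j τ n) : c • v ∈ stage j τ n := by
  induction n generalizing v with
  | zero =>
    obtain ⟨a, rfl⟩ := hv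
    exact ⟨c • a, map_smul j c a⟩
  | succ n ih =>
    obtain ⟨a, v, hv, rfl⟩ := hv
    exact ⟨c • a, c • v, ih hv, by rw [map_smul, map_smul, smul_add]⟩

end Stage

namespace IsCovariantPair

variable {X : Type*} [TopologicalSpace X] {P : PartialDynSys X} {p q : C(X, ℂ)}

section Stage

variable {A B : Type*} [NormedRing A] [NormedAlgebra ℂ A] [StarRing A]
    [NormedRing B] [NormedAlgebra ℂ B] [StarRing B]
    {i : C(X, ℂ) →⋆ₙₐ[ℂ] A} {σ' τ' : A →ₗ[ℂ] A} {j : C(X, ℂ) →⋆ₙₐ[ℂ] B} {σ τ : B →ₗ[ℂ] B}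

theorem map_mul_right (h : IsCovariantPair P p q j σ τ) (v : B) (b : C(X, ℂ)) :
    τ v * j b = τ (v * j (P.endo b)) := by
  have := congrArg star (h.mul_map (star b) (star v))
  rwa [h.star_comm, map_star, star_mul, star_star, star_star, ← h.star_comm, star_mul,
    map_star, map_star, star_star, star_star] at this

theorem star_mem_stage (hA : IsCovariantPair P p q i σ' τ')
    (hB : IsCovariantPair P p q j σ τ) (n : ℕ) {v : A × B} (hv : v ∈ stage (i.prod j) (τ'.prodMap τ) n) :
    star v ∈ stage (i.prod j) (τ'.prodMap τ) n := by
  induction n generalizing v with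
  | zero =>
    obtain ⟨a, rfl⟩ := hv
    exact ⟨star a, map_star _ a⟩
  | succ n ih =>
    obtain ⟨a, v, hv, rfl⟩ := hv
    refine ⟨star a, star v, ih hv, ?_⟩
    rw [star_add, ← map_star]
    congr 1
    exact Prod.ext (hA.star_comm _).symm (hB.star_comm _).symm

/-- The product `(j(a) + τ(v))(j(b) + τ(w))` equals `j(ab) + τ(j(δa)w + v j(δb) + v j(p) w)`, whose
inner term has one level fewer. Working in `A × B` expands both models with the same coefficients.
-/
theorem mul_mem_stage (hA : IsCovariantPair P p q i σ' τ')
    (hB : IsCovariantPair P p q j σ τ) (n : ℕ) {v w : A × B} (hv : v ∈ stage (i.prod j) (τ'.prodMap τ) n)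
    (hw : w ∈ stage (i.prod j) (τ'.prodMap τ) n) : v * w ∈ stage (i.prod j) (τ'.prodMap τ) n := by
  induction n generalizing v w with
  | zero =>
    obtain ⟨a, rfl⟩ := hv
    obtain ⟨b, rfl⟩ := hw
    exact ⟨a * b, map_mul _ a b⟩
  | succ n ih =>
    obtain ⟨a, v, hv, rfl⟩ := hv
    obtain ⟨b, w, hw, rfl⟩ := hw
    have hj := map_mem_stage (i.prod j) (τ'.prodMap τ) n
    refine ⟨a * b, i.prod j (P.endo a) * w + v * i.prod j (P.endo b) + v * i.prod j p * w,
      add_mem_stage _ _ n (add_mem_stage _ _ n (ih (hj _) hw) (ih hv (hj _)))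
        (ih (ih hv (hj _)) hw), ?_⟩
    ext
    · simp only [Prod.fst_mul, Prod.fst_add, NonUnitalStarAlgHom.prod_apply,
        LinearMap.prodMap_apply, map_add, map_mul, add_mul, mul_add, hA.mul_map,
        hA.map_mul_right, hA.map_mul_map]
      abel
    · simp only [Prod.snd_mul, Prod.snd_add, NonUnitalStarAlgHom.prod_apply,
        LinearMap.prodMap_apply, map_add, map_mul, add_mul, mul_add, hB.mul_map,
        hB.map_mul_right, hB.map_mul_map]
      abel

/-- `σ` undoes `τ` up to the corner cut out by `p`: `σ(j(a) + τ(w)) = j(δa) + j(p) w j(p)`. This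
loss of one level makes the norm induction possible. -/
theorem compress_mem_stage (hA : IsCovariantPair P p q i σ' τ')
    (hB : IsCovariantPair P p q j σ τ) (n : ℕ) {v : A × B}
    (hv : v ∈ stage (i.prod j) (τ'.prodMap τ) (n + 1)) :
    σ'.prodMap σ v ∈ stage (i.prod j) (τ'.prodMap τ) n := by
  obtain ⟨a, w, hw, rfl⟩ := hv
  have hj := map_mem_stage (i.prod j) (τ'.prodMap τ) n
  have : σ'.prodMap σ (i.prod j a + τ'.prodMap τ w) =
      i.prod j (P.endo a) + i.prod j p * w * i.prod j p := by
    ext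
    · simp [hA.compress, hA.compress_map]
    · simp [hB.compress, hB.compress_map]
  rw [this]
  exact add_mem_stage _ _ n (hj _) (mul_mem_stage hA hB n (mul_mem_stage hA hB n (hj _) hw) (hj _))

/-- Both norms obey the same recursion: the term `j(a - aq)` has equal norms by assumption, and the
compressed element lies one stage lower. -/
theorem norm_eq_of_mem_stage (hA : IsCovariantPair P p q i σ' τ')
    (hB : IsCovariantPair P p q j σ τ) (hij : ∀ a, ‖i a‖ = ‖j a‖) (n : ℕ) {v : A × B}
    (hv : v ∈ stage (i.prod j) (τ'.prodMap τ) n) : ‖v.1‖ = ‖v.2‖ := by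
  induction n generalizing v with
  | zero =>
    obtain ⟨a, rfl⟩ := hv
    exact hij a
  | succ n ih =>
    have hs := ih (compress_mem_stage hA hB n hv)
    obtain ⟨a, w, hw, rfl⟩ := hv
    refine (hA.norm_eq a w.1).trans (Eq.trans ?_ (hB.norm_eq a w.2).symm)
    rw [hij]
    exact congrArg _ hs

/-- The union of all stages in the product of two covariant pairs. -/
def graph (hA : IsCovariantPair P p q i σ' τ') (hB : IsCovariantPair P p q j σ τ) :
    NonUnitalStarSubalgebra ℂ (A × B) where
  carrier := ⋃ n, stage (i.prod j) (τ'.prodMap τ) n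
  zero_mem' := Set.mem_iUnion.2 ⟨0, 0, by simp⟩
  add_mem' {v w} hv hw := by
    obtain ⟨m, hv⟩ := Set.mem_iUnion.1 hv
    obtain ⟨n, hw⟩ := Set.mem_iUnion.1 hw
    exact Set.mem_iUnion.2 ⟨max m n, add_mem_stage _ _ _ (stage_mono _ _ (le_max_left m n) hv)
      (stage_mono _ _ (le_max_right m n) hw)⟩
  mul_mem' {v w} hv hw := by
    obtain ⟨m, hv⟩ := Set.mem_iUnion.1 hv
    obtain ⟨n, hw⟩ := Set.mem_iUnion.1 hw
    exact Set.mem_iUnion.2 ⟨max m n, mul_mem_stage hA hB _ (stage_mono _ _ (le_max_left m n) hv)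
      (stage_mono _ _ (le_max_right m n) hw)⟩
  smul_mem' c v hv := by
    obtain ⟨m, hv⟩ := Set.mem_iUnion.1 hv
    exact Set.mem_iUnion.2 ⟨m, smul_mem_stage _ _ _ c hv⟩
  star_mem' {v} hv := by
    obtain ⟨m, hv⟩ := Set.mem_iUnion.1 hv
    exact Set.mem_iUnion.2 ⟨m, star_mem_stage hA hB _ hv⟩

end Stage

end IsCovariantPair

/-! ### Passage from a graph to a homomorphism -/

/-- A `*`-subalgebra of `A × B` on which both coordinates have the same norm, and whose first
coordinates are dense, lies in the graph of an isometric `*`-homomorphism. -/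
theorem exists_isometric_starHom_of_graph {A B : Type*} [CStarAlgebra A] [CStarAlgebra B]
    (G : NonUnitalStarSubalgebra ℂ (A × B)) (hG : ∀ v ∈ G, ‖v.1‖ = ‖v.2‖)
    (hd : Dense (Prod.fst '' (G : Set (A × B)))) :
    ∃ ρ : A →⋆ₙₐ[ℂ] B, (∀ a, ‖ρ a‖ = ‖a‖) ∧ ∀ v ∈ G, ρ v.1 = v.2 := by
  have hn : ∀ v ∈ G.topologicalClosure, ‖v.1‖ = ‖v.2‖ := fun v hv =>
    closure_minimal (t := {v : A × B | ‖v.1‖ = ‖v.2‖}) hG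
      (isClosed_eq (by fun_prop) (by fun_prop)) hv
  -- The product norm is the maximum of two equal numbers, so the first projection is isometric on
  -- the closure of `G`. Its range is closed by completeness and dense by assumption, hence
  -- everything.
  have hiso : Isometry fun v : G.topologicalClosure => v.1.1 := by
    refine Isometry.of_dist_eq fun v w => ?_
    have h := hn (v.1 - w.1) (sub_mem v.2 w.2)
    change dist v.1.1 w.1.1 = dist v.1 w.1
    rw [dist_eq_norm, dist_eq_norm, Prod.norm_def, ← h, max_self, Prod.fst_sub]
  have : CompleteSpace G.topologicalClosure :=
    G.isClosed_topologicalClosure.completeSpace_coe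
  have hsurj : Function.Surjective fun v : G.topologicalClosure => v.1.1 := by
    rw [← Set.range_eq_univ, ← hiso.isClosedEmbedding.isClosed_range.closure_eq]
    refine (hd.mono ?_).closure_eq
    rintro _ ⟨v, hv, rfl⟩
    exact ⟨⟨v, G.le_topologicalClosure hv⟩, rfl⟩
  have hex : ∀ a, ∃ b, (a, b) ∈ G.topologicalClosure := fun a => by
    obtain ⟨⟨⟨_, b⟩, hb⟩, rfl⟩ := hsurj a
    exact ⟨b, hb⟩
  choose f hf using hex
  -- Two elements over the same `a` differ by some `(0, c)`, and equality of norms forces `c = 0`.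
  -- All algebraic laws for `f` follow from this uniqueness.
  have huniq : ∀ {a b}, (a, b) ∈ G.topologicalClosure → f a = b := fun {a b} h => by
    have := hn _ (sub_mem (hf a) h)
    simp only [Prod.mk_sub_mk, sub_self, norm_zero] at this
    exact sub_eq_zero.1 (norm_eq_zero.1 this.symm)
  refine ⟨{ toFun := f
            map_smul' := fun c a => huniq (SMulMemClass.smul_mem (s := G.topologicalClosure) c (hf a))
            map_zero' := huniq (zero_mem _)
            map_add' := fun a b => huniq (add_mem (hf a) (hf b))
            map_mul' := fun a b => huniq (mul_mem (hf a) (hf b))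
            map_star' := fun a => huniq (star_mem (hf a)) },
    fun a => (hn _ (hf a)).symm, fun v hv => huniq (G.le_topologicalClosure hv)⟩

/-! ### The function model `C(X̃)` -/

namespace PartialDynSys

variable {X : Type*} [TopologicalSpace X] (P : PartialDynSys X)

variable {P} in
theorem MapsTo.endo_apply {x y : X} (h : P.MapsTo x y) (a : C(X, ℂ)) : P.endo a x = a y := by
  obtain ⟨hx, rfl⟩ := h
  exact dif_pos hx

theorem endo_apply_of_notMem {x : X} (h : x ∉ P.dom) (a : C(X, ℂ)) : P.endo a x = 0 :=
  dif_neg h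

variable {P} in
theorem MapsTo.proj {x y : P.Ext} (h : P.rev.MapsTo x y) : P.MapsTo (P.proj x) (P.proj y) := by
  obtain ⟨hx, rfl⟩ := h
  exact ⟨hx, Sum.inl.inj (P.coord_zero (P.rev.map ⟨x, hx⟩))⟩

/-- The embedding `a ↦ a ∘ Φ` of `C(X)` into `C(X̃)`. -/
noncomputable def pullback : C(X, ℂ) →⋆ₙₐ[ℂ] C(P.Ext, ℂ) where
  toFun a := a.comp P.proj
  map_smul' _ _ := rfl
  map_zero' := rfl
  map_add' _ _ := rfl
  map_mul' _ _ := rfl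
  map_star' _ := rfl

theorem pullback_apply (a : C(X, ℂ)) (x : P.Ext) : P.pullback a x = a (P.proj x) := rfl

theorem norm_pullback [CompactSpace X] [CompactSpace P.Ext] (a : C(X, ℂ)) :
    ‖P.pullback a‖ = ‖a‖ := by
  apply le_antisymm
  · exact (ContinuousMap.norm_le _ (norm_nonneg a)).2 fun x => a.norm_coe_le_norm _
  · refine (ContinuousMap.norm_le _ (norm_nonneg _)).2 fun z => ?_
    obtain ⟨x, rfl⟩ := P.proj_surjective z
    exact (P.pullback a).norm_coe_le_norm x

theorem mapsTo_or_notMem_dom (x : P.Ext) :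
    (∃ y, P.rev.MapsTo x y) ∨ P.proj x ∉ P.dom := by
  by_cases h : P.proj x ∈ P.dom
  · exact Or.inl ⟨_, h, rfl⟩
  · exact Or.inr h

theorem mapsTo_or_notMem_image (x : P.Ext) :
    (∃ y, P.rev.MapsTo y x) ∨ x ∉ P.revInv.dom := by
  by_cases h : x ∈ P.revInv.dom
  · exact Or.inl ⟨_, (P.rev_mapsTo_iff _ x).2 ⟨h, rfl⟩⟩
  · exact Or.inr h

variable {P} in
theorem MapsTo.revInv_endo_apply {x y : P.Ext} (h : P.rev.MapsTo x y) (f : C(P.Ext, ℂ)) :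
    P.revInv.endo f y = f x :=
  ((P.rev_mapsTo_iff x y).1 h).endo_apply f

/-- Since `α̃` is a bijection from `Δ̃₁` onto `Δ̃₋₁`, each identity is checked at the two ends of a
pair `y = α̃(x)`; off these sets both sides vanish. -/
theorem isCovariantPair_pullback [CompactSpace P.Ext] (hK : IsClopen P.image) :
    IsCovariantPair P (clopenIndicator P.isClopen_dom) (clopenIndicator hK) P.pullback
      (P.rev.endo : C(P.Ext, ℂ) →ₗ[ℂ] C(P.Ext, ℂ))
      (P.revInv.endo : C(P.Ext, ℂ) →ₗ[ℂ] C(P.Ext, ℂ)) where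
  star_comm v := map_star P.revInv.endo v
  compress a := by
    ext x
    change P.rev.endo (P.pullback a) x = P.endo a (P.proj x)
    rcases P.mapsTo_or_notMem_dom x with ⟨y, h⟩ | h
    · rw [h.endo_apply, h.proj.endo_apply, pullback_apply]
    · rw [P.endo_apply_of_notMem h, P.rev.endo_apply_of_notMem h]
  mul_map b f := by
    ext x
    change b (P.proj x) * P.revInv.endo f x = P.revInv.endo (P.pullback (P.endo b) * f) x
    rcases P.mapsTo_or_notMem_image x with ⟨y, h⟩ | h
    · rw [h.revInv_endo_apply, h.revInv_endo_apply, ContinuousMap.mul_apply, pullback_apply,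
        h.proj.endo_apply]
    · rw [P.revInv.endo_apply_of_notMem h, P.revInv.endo_apply_of_notMem h, mul_zero]
  map_mul_map f g := by
    ext x
    change P.revInv.endo f x * P.revInv.endo g x = P.revInv.endo (f * P.pullback _ * g) x
    rcases P.mapsTo_or_notMem_image x with ⟨y, h⟩ | h
    · rw [h.revInv_endo_apply, h.revInv_endo_apply, h.revInv_endo_apply, ContinuousMap.mul_apply,
        ContinuousMap.mul_apply, pullback_apply, clopenIndicator_of_mem _ h.proj.1, mul_one]
    · rw [P.revInv.endo_apply_of_notMem h, P.revInv.endo_apply_of_notMem h,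
        P.revInv.endo_apply_of_notMem h, mul_zero]
  compress_map f := by
    ext x
    change P.rev.endo (P.revInv.endo f) x = P.pullback _ x * f x * P.pullback _ x
    rw [pullback_apply]
    rcases P.mapsTo_or_notMem_dom x with ⟨y, h⟩ | h
    · rw [h.endo_apply, h.revInv_endo_apply, clopenIndicator_of_mem _ h.proj.1, one_mul, mul_one]
    · rw [P.rev.endo_apply_of_notMem h, clopenIndicator_of_notMem _ h, mul_zero]
  map_mul_proj f := by
    ext x
    change P.revInv.endo f x * clopenIndicator hK (P.proj x) = P.revInv.endo f x
    rcases P.mapsTo_or_notMem_image x with ⟨y, h⟩ | h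
    · obtain ⟨hd, he⟩ := h.proj
      rw [clopenIndicator_of_mem hK (show P.proj x ∈ P.image from ⟨_, he⟩), mul_one]
    · rw [P.revInv.endo_apply_of_notMem h, zero_mul]
  norm_eq a f := by
    -- Off `Δ̃₋₁` both the `τ` term and the pulled-back indicator of `Δ₋₁` vanish, so the element is
    -- seen there by `a - aq`. At `α̃(y)` its value is that of its `σ`-image at `y`.
    have hval : ∀ x, x ∉ P.revInv.dom → P.pullback (a - a * clopenIndicator hK) x =
        (P.pullback a + P.revInv.endo f) x := fun x h => by
      have h' : P.proj x ∉ P.image := by rwa [revInv_dom] at h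
      simp [pullback_apply, clopenIndicator_of_notMem _ h', P.revInv.endo_apply_of_notMem h]
    change ‖P.pullback a + P.revInv.endo f‖ = max _ ‖P.rev.endo (P.pullback a + P.revInv.endo f)‖
    apply le_antisymm
    · refine (ContinuousMap.norm_le _ (le_max_of_le_left (norm_nonneg _))).2 fun x => ?_
      rcases P.mapsTo_or_notMem_image x with ⟨y, h⟩ | h
      · rw [← h.endo_apply]
        exact (ContinuousMap.norm_coe_le_norm _ y).trans (le_max_right _ _)
      · rw [← hval x h]
        exact (ContinuousMap.norm_coe_le_norm _ x).trans (le_max_left _ _)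
    · refine max_le ((ContinuousMap.norm_le _ (norm_nonneg _)).2 fun x => ?_)
        ((ContinuousMap.norm_le _ (norm_nonneg _)).2 fun x => ?_)
      · by_cases h : x ∈ P.revInv.dom
        · have h' : P.proj x ∈ P.image := by rwa [revInv_dom] at h
          simp [pullback_apply, clopenIndicator_of_mem _ h']
        · rw [hval x h]
          exact ContinuousMap.norm_coe_le_norm _ x
      · rcases P.mapsTo_or_notMem_dom x with ⟨y, h⟩ | h
        · rw [h.endo_apply]
          exact ContinuousMap.norm_coe_le_norm _ y
        · rw [P.rev.endo_apply_of_notMem h, norm_zero]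
          exact norm_nonneg _

theorem coord_succ_eq_zero (x : P.Ext) {n : ℕ} (h : x.1 n = Sum.inr ()) :
    x.1 (n + 1) = Sum.inr () := by
  rcases ((P.mem_ext_iff x.1).1 x.2).2 n with ⟨d, hd, -⟩ | ⟨h', -⟩
  · rw [h] at hd
    cases hd
  · exact h'

theorem bracket_apply (N : ℕ) (a : ℕ → C(X, ℂ)) (x : P.Ext) :
    P.bracket N a x = ∑ n ∈ Finset.range (N + 1), Sum.elim (a n) (fun _ => 0) (x.1 n) := rfl

theorem bracket_zero (a : ℕ → C(X, ℂ)) : P.bracket 0 a = P.pullback (a 0) := by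
  ext x
  simp [bracket_apply, P.coord_zero, pullback_apply]

theorem bracket_succ (N : ℕ) (a : ℕ → C(X, ℂ)) :
    P.bracket (N + 1) a = P.pullback (a 0) + P.revInv.endo (P.bracket N fun n => a (n + 1)) := by
  ext x
  rw [bracket_apply, Finset.sum_range_succ', P.coord_zero, ContinuousMap.add_apply, add_comm]
  congr 1
  by_cases h : x ∈ P.revInv.dom
  · rw [MapsTo.endo_apply ⟨h, rfl⟩, bracket_apply]
    rfl
  · rw [P.revInv.endo_apply_of_notMem h]
    -- Outside `Δ̃₋₁` the coordinate `x₁` is zero, hence so are all later ones, and only the term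
    -- `a₀(x₀)` survives.
    have hz : ∀ n, x.1 (n + 1) = Sum.inr () := fun n => by
      induction n with
      | zero => exact not_not.1 h
      | succ n ih => exact P.coord_succ_eq_zero x ih
    exact Finset.sum_eq_zero fun n _ => by rw [hz]; rfl

end PartialDynSys

/-! ### The operator model `L(H)` -/

section Operators

variable {X : Type*} [TopologicalSpace X]
  {H : Type*} [NormedAddCommGroup H] [InnerProductSpace ℂ H] [CompleteSpace H]

theorem IsStarProjection.norm_apply_sq_add {p : H →L[ℂ] H} (hp : IsStarProjection p) (v : H) :
    ‖v - p v‖ ^ 2 + ‖p v‖ ^ 2 = ‖v‖ ^ 2 := by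
  have hpp : p (p v) = p v := congrArg (fun T : H →L[ℂ] H => T v) hp.isIdempotentElem
  have h0 : inner ℂ (v - p v) (p v) = 0 := by
    have := ContinuousLinearMap.adjoint_inner_left p v (v - p v)
    rw [← ContinuousLinearMap.star_eq_adjoint, hp.isSelfAdjoint.star_eq, map_sub, hpp, sub_self,
      inner_zero_left] at this
    exact this.symm
  have := norm_add_sq_eq_norm_sq_add_norm_sq_of_inner_eq_zero _ _ h0
  rw [sub_add_cancel] at this
  linarith [this]

/-- `T` is block diagonal for `H = ker p ⊕ ran p`, so Pythagoras bounds its norm by the larger of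
the two blocks. -/
theorem norm_le_max_of_commute {p T : H →L[ℂ] H} (hp : IsStarProjection p) (h : T * p = p * T) :
    ‖T‖ ≤ max ‖T - T * p‖ ‖T * p‖ := by
  set M := max ‖T - T * p‖ ‖T * p‖
  have hM : 0 ≤ M := le_max_of_le_left (norm_nonneg _)
  have hT : ∀ v, T (p v) = p (T v) := fun v => congrArg (fun S : H →L[ℂ] H => S v) h
  have hpp : ∀ v, p (p v) = p v := fun v =>
    congrArg (fun S : H →L[ℂ] H => S v) hp.isIdempotentElem
  refine T.opNorm_le_bound hM fun v => ?_
  have h1 : ‖T v - p (T v)‖ ≤ M * ‖v - p v‖ := by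
    have := (T - T * p).le_of_opNorm_le (le_max_left _ _ : _ ≤ M) (v - p v)
    simpa [hT, hpp] using this
  have h2 : ‖p (T v)‖ ≤ M * ‖p v‖ := by
    have := (T * p).le_of_opNorm_le (le_max_right _ _ : _ ≤ M) (p v)
    simpa [hT, hpp] using this
  refine le_of_sq_le_sq ?_ (by positivity)
  rw [← hp.norm_apply_sq_add (T v), mul_pow, ← hp.norm_apply_sq_add v, mul_add, ← mul_pow,
    ← mul_pow]
  gcongr

/-- The compression `T ↦ V* T V`. -/
noncomputable def conjLinear (V : H →L[ℂ] H) : (H →L[ℂ] H) →ₗ[ℂ] (H →L[ℂ] H) :=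
  LinearMap.mulLeft ℂ (star V) ∘ₗ LinearMap.mulRight ℂ V

theorem conjLinear_apply (V T : H →L[ℂ] H) : conjLinear V T = star V * (T * V) := rfl

variable {P : PartialDynSys X} {π : C(X, ℂ) →⋆ₙₐ[ℂ] (H →L[ℂ] H)} {U : H →L[ℂ] H}

theorem IsCovRep.star_mul_self (h : IsCovRep P π U) (hK : IsClopen P.image) :
    star U * U = π (clopenIndicator hK) := by
  have hU := h.isPartialIsometry
  rw [essSpace_vanishingOutside hK, essSpace_vanishingOutside P.isClopen_dom] at hU
  exact hU.star_mul_self (isStarProjection_map_clopenIndicator hK π)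

theorem IsCovRep.self_mul_star (h : IsCovRep P π U) (hK : IsClopen P.image) :
    U * star U = π (clopenIndicator P.isClopen_dom) := by
  have hU := h.isPartialIsometry
  rw [essSpace_vanishingOutside hK, essSpace_vanishingOutside P.isClopen_dom] at hU
  exact hU.self_mul_star (isStarProjection_map_clopenIndicator hK π)
    (isStarProjection_map_clopenIndicator P.isClopen_dom π)

theorem IsCovRep.isCovariantPair (h : IsCovRep P π U) (hK : IsClopen P.image) :
    IsCovariantPair P (clopenIndicator P.isClopen_dom) (clopenIndicator hK) π
      (conjLinear (star U)) (conjLinear U) := by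
  have hq := h.star_mul_self hK
  have hp := h.self_mul_star hK
  have hproj := isStarProjection_map_clopenIndicator hK π
  have hUUU : U * star U * U = U := by
    have hU := h.isPartialIsometry
    rw [essSpace_vanishingOutside hK, essSpace_vanishingOutside P.isClopen_dom] at hU
    exact hU.mul_star_mul hproj
  have hUq : U * π (clopenIndicator hK) = U := by rw [← hq, ← mul_assoc, hUUU]
  have hqU : π (clopenIndicator hK) * star U = star U := by
    simpa [hproj.isSelfAdjoint.star_eq] using congrArg star hUq
  -- Covariance turns the left side into `U*U π(b) U*`. As `U*U = π(q)` with `C(X)` commutative, the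
  -- projection moves past `π(b)` and is absorbed by `U*`.
  have hcomm : ∀ b, star U * π (P.endo b) = π b * star U := fun b => by
    rw [← h.covariant, ← mul_assoc, ← mul_assoc, hq, ← map_mul, mul_comm, map_mul, mul_assoc, hqU]
  have hnormU : ‖U‖ ≤ 1 := by
    have h1 : ‖star U * U‖ ≤ 1 := by rw [hq]; exact hproj.norm_le
    rw [CStarRing.norm_star_mul_self] at h1
    nlinarith [norm_nonneg U]
  have hconj : ∀ T, ‖U * (T * star U)‖ ≤ ‖T‖ := fun T => by
    calc ‖U * (T * star U)‖ ≤ ‖U‖ * (‖T‖ * ‖star U‖) :=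
          (norm_mul_le _ _).trans (by gcongr; exact norm_mul_le _ _)
      _ ≤ 1 * (‖T‖ * 1) := by rw [norm_star]; gcongr
      _ = ‖T‖ := by ring
  have hconj' : ∀ T, ‖star U * T * U‖ ≤ ‖T‖ := fun T => by
    calc ‖star U * T * U‖ ≤ ‖star U‖ * ‖T‖ * ‖U‖ :=
          (norm_mul_le _ _).trans (by gcongr; exact norm_mul_le _ _)
      _ ≤ 1 * ‖T‖ * 1 := by rw [norm_star]; gcongr
      _ = ‖T‖ := by ring
  refine ⟨fun v => ?_, fun a => ?_, fun b v => ?_, fun v w => ?_, fun v => ?_, fun v => ?_,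
    fun a w => ?_⟩
  · simp only [conjLinear_apply, star_mul, star_star, mul_assoc]
  · rw [conjLinear_apply, star_star, ← mul_assoc, h.covariant]
  · simp only [conjLinear_apply]
    rw [← mul_assoc, ← hcomm]
    simp only [mul_assoc]
  · simp only [conjLinear_apply, ← hp, mul_assoc]
  · simp only [conjLinear_apply, ← hp, mul_assoc, star_star]
  · simp only [conjLinear_apply, mul_assoc, hUq]
  · set T := π a + conjLinear U w with hT
    set Q := π (clopenIndicator hK) with hQ
    have hTQ : T * Q = π (a * clopenIndicator hK) + conjLinear U w := by
      rw [hT, add_mul, map_mul, conjLinear_apply]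
      simp only [mul_assoc, hUq]
      rfl
    have hQT : Q * T = T * Q := by
      rw [hTQ, hT, mul_add, hQ, ← map_mul, mul_comm, conjLinear_apply, ← mul_assoc, ← hQ, hqU]
    have hsub : T - T * Q = π (a - a * clopenIndicator hK) := by
      rw [hTQ, hT, map_sub, add_sub_add_right_eq_sub]
    -- The block `TQ = QTQ` is recovered from the compression `UTU*` by conjugating back. As `U` is
    -- a contraction, neither conjugation increases the norm, so this block has the norm of `UTU*`.
    have hQTQ : T * Q = star U * (U * (T * star U)) * U := by
      have : T * Q = Q * T * Q := by
        rw [hQT, mul_assoc, hproj.isIdempotentElem.eq]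
      rw [this, ← hq]
      simp only [mul_assoc]
    rw [← hsub, conjLinear_apply, star_star]
    apply le_antisymm
    · refine (norm_le_max_of_commute hproj hQT.symm).trans (max_le_max le_rfl ?_)
      rw [hQTQ]
      exact hconj' _
    · refine max_le ?_ (hconj T)
      calc ‖T - T * Q‖ = ‖T * (1 - Q)‖ := by rw [mul_sub, mul_one]
        _ ≤ ‖T‖ * ‖1 - Q‖ := norm_mul_le _ _
        _ ≤ ‖T‖ * 1 := by gcongr; exact hproj.one_sub.norm_le
        _ = ‖T‖ := mul_one _

theorem sum_zero_succ (π : C(X, ℂ) →⋆ₙₐ[ℂ] (H →L[ℂ] H)) (U : H →L[ℂ] H) (N : ℕ)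
    (a : ℕ → C(X, ℂ)) :
    ∑ n ∈ Finset.range (N + 1 + 1), star U ^ n * π (a n) * U ^ n =
      π (a 0) + conjLinear U
        (∑ n ∈ Finset.range (N + 1), star U ^ n * π (a (n + 1)) * U ^ n) := by
  rw [Finset.sum_range_succ', map_sum, add_comm]
  refine congrArg₂ _ (by simp) (Finset.sum_congr rfl fun n _ => ?_)
  rw [conjLinear_apply, pow_succ' (star U), pow_succ U]
  simp only [mul_assoc]

/-- Both coordinates satisfy the same Horner recursion, which identifies the abstract stages with
the pairs to be matched by the isomorphism. -/
theorem mem_stage_iff (N : ℕ) (v : C(P.Ext, ℂ) × (H →L[ℂ] H)) :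
    v ∈ stage (P.pullback.prod π) ((P.revInv.endo : C(P.Ext, ℂ) →ₗ[ℂ] C(P.Ext, ℂ)).prodMap
        (conjLinear U)) N ↔
      ∃ a, v = (P.bracket N a, ∑ n ∈ Finset.range (N + 1), star U ^ n * π (a n) * U ^ n) := by
  induction N generalizing v with
  | zero =>
    constructor
    · rintro ⟨a, rfl⟩
      exact ⟨fun _ => a, by simp [P.bracket_zero]⟩
    · rintro ⟨a, rfl⟩
      exact ⟨a 0, by simp [P.bracket_zero]⟩
  | succ N ih =>
    constructor
    · rintro ⟨a, w, hw, rfl⟩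
      obtain ⟨b, rfl⟩ := (ih w).1 hw
      refine ⟨fun n => Nat.casesOn n a b, ?_⟩
      rw [P.bracket_succ, sum_zero_succ]
      rfl
    · rintro ⟨a, rfl⟩
      refine ⟨a 0, _, (ih _).2 ⟨fun n => a (n + 1), rfl⟩, ?_⟩
      rw [P.bracket_succ, sum_zero_succ]
      rfl

end Operators

/-! ### Density and construction of the extended representation -/

namespace PartialDynSys

variable {X : Type*} [TopologicalSpace X] (P : PartialDynSys X)

/-- The functions `[a₀, …, a_N, 0, …]` separate the points of the extension. -/
theorem exists_bracket_ne [CompactSpace X] [T2Space X] {x y : P.Ext} (hxy : x ≠ y) :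
    ∃ N a, P.bracket N a x ≠ P.bracket N a y := by
  obtain ⟨n, hn⟩ : ∃ n, x.1 n ≠ y.1 n := by
    by_contra! h
    exact hxy (Subtype.ext (funext h))
  have single : ∀ (a : C(X, ℂ)) (z : P.Ext),
      P.bracket n (Pi.single n a) z = Sum.elim a (fun _ => 0) (z.1 n) := fun a z => by
    rw [bracket_apply, Finset.sum_eq_single n]
    · simp
    · intro m _ hm
      rw [Pi.single_eq_of_ne hm]
      rcases z.1 m with _ | _ <;> rfl
    · simp
  suffices ∃ a : C(X, ℂ), Sum.elim a (fun _ => 0) (x.1 n) ≠ Sum.elim a (fun _ => 0) (y.1 n) by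
    obtain ⟨a, ha⟩ := this
    exact ⟨n, Pi.single n a, by rwa [single, single]⟩
  -- Two distinct points are separated by a Urysohn function; a point is separated from the added
  -- zero by the constant 1.
  rcases hx : x.1 n with u | ⟨⟩ <;> rcases hy : y.1 n with v | ⟨⟩
  · have huv : u ≠ v := fun h => hn (by rw [hx, hy, h])
    obtain ⟨f, hf0, hf1, -⟩ := exists_continuous_zero_one_of_isClosed
      (isClosed_singleton (x := u)) (isClosed_singleton (x := v)) (by simpa using huv)
    refine ⟨⟨fun z => (f z : ℂ), by fun_prop⟩, ?_⟩
    have h0 : f u = 0 := hf0 rfl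
    have h1 : f v = 1 := hf1 rfl
    simp [h0, h1]
  · exact ⟨1, by simp⟩
  · exact ⟨1, by simp⟩
  · exact absurd (hx.trans hy.symm) hn

end PartialDynSys

theorem NonUnitalStarAlgHom.continuous_of_cstar {A B : Type*} [NonUnitalCStarAlgebra A]
    [NonUnitalCStarAlgebra B] (φ : A →⋆ₙₐ[ℂ] B) : Continuous φ :=
  AddMonoidHomClass.continuous_of_bound φ 1 fun a => by
    simpa only [one_mul] using NonUnitalStarAlgHom.norm_apply_le φ a

section Extension

variable {X : Type*} [TopologicalSpace X] [CompactSpace X] [T2Space X]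
  {P : PartialDynSys X} {H : Type*} [NormedAddCommGroup H] [InnerProductSpace ℂ H]
  [CompleteSpace H] {π : C(X, ℂ) →⋆ₙₐ[ℂ] (H →L[ℂ] H)} {U : H →L[ℂ] H}

theorem dense_fst_graph [CompactSpace P.Ext] {p q : C(X, ℂ)}
    {σ' : C(P.Ext, ℂ) →ₗ[ℂ] C(P.Ext, ℂ)} {σ : (H →L[ℂ] H) →ₗ[ℂ] (H →L[ℂ] H)}
    (hA : IsCovariantPair P p q P.pullback σ' (P.revInv.endo : C(P.Ext, ℂ) →ₗ[ℂ] C(P.Ext, ℂ)))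
    (hB : IsCovariantPair P p q π σ (conjLinear U)) :
    Dense (Prod.fst '' (hA.graph hB : Set (C(P.Ext, ℂ) × (H →L[ℂ] H)))) := by
  let S : StarSubalgebra ℂ C(P.Ext, ℂ) :=
    { carrier := Prod.fst '' (hA.graph hB : Set (C(P.Ext, ℂ) × (H →L[ℂ] H)))
      mul_mem' := by
        rintro _ _ ⟨v, hv, rfl⟩ ⟨w, hw, rfl⟩
        exact ⟨v * w, mul_mem hv hw, rfl⟩
      add_mem' := by
        rintro _ _ ⟨v, hv, rfl⟩ ⟨w, hw, rfl⟩
        exact ⟨v + w, add_mem hv hw, rfl⟩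
      -- Constants lie in stage 0 as pullbacks of constants on `X`. Only first coordinates matter
      -- here, so `π` need not be unital.
      algebraMap_mem' := fun c => by
        refine ⟨P.pullback.prod π (algebraMap ℂ C(X, ℂ) c), ?_, rfl⟩
        exact Set.mem_iUnion.2 ⟨0, _, rfl⟩
      star_mem' := by
        rintro _ ⟨v, hv, rfl⟩
        exact ⟨star v, star_mem hv, rfl⟩ }
  have hS := ContinuousMap.starSubalgebra_topologicalClosure_eq_top_of_separatesPoints S (by
    intro x y hxy
    obtain ⟨N, a, ha⟩ := P.exists_bracket_ne hxy
    exact ⟨_, ⟨P.bracket N a, ⟨_, Set.mem_iUnion.2 ⟨N, (mem_stage_iff N _).2 ⟨a, rfl⟩⟩, rfl⟩,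
      rfl⟩, ha⟩)
  intro f
  change f ∈ closure (S : Set C(P.Ext, ℂ))
  rw [← StarSubalgebra.topologicalClosure_coe, hS]
  trivial

/-- The functions `[a₀, …, a_N, 0, …]` are dense in `C(X̃)`. -/
theorem dense_bracket [CompactSpace P.Ext] (hK : IsClopen P.image) (h : IsCovRep P π U) :
    Dense {f | ∃ N a, f = P.bracket N a} := by
  refine (dense_fst_graph (P.isCovariantPair_pullback hK) (h.isCovariantPair hK)).mono ?_
  rintro _ ⟨v, hv, rfl⟩
  obtain ⟨N, hN⟩ := Set.mem_iUnion.1 hv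
  obtain ⟨a, rfl⟩ := (mem_stage_iff N v).1 hN
  exact ⟨N, a, rfl⟩

theorem IsCovFaithRep.exists_extension [CompactSpace P.Ext] (hK : IsClopen P.image)
    (h : IsCovFaithRep P π U) :
    ∃ ρ : C(P.Ext, ℂ) →⋆ₙₐ[ℂ] (H →L[ℂ] H), (∀ f, ‖ρ f‖ = ‖f‖) ∧
      (∀ N a, ρ (P.bracket N a) =
        ∑ n ∈ Finset.range (N + 1), star U ^ n * π (a n) * U ^ n) ∧
      (∀ f, ρ (P.rev.endo f) = U * ρ f * star U) ∧
      (∀ f, ρ (P.revInv.endo f) = star U * ρ f * U) := by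
  have hA := P.isCovariantPair_pullback hK
  have hB := h.isCovariantPair hK
  have hd := dense_fst_graph hA hB
  obtain ⟨ρ, hnorm, hρ⟩ := exists_isometric_starHom_of_graph (hA.graph hB) (fun v hv => by
    obtain ⟨N, hN⟩ := Set.mem_iUnion.1 hv
    exact IsCovariantPair.norm_eq_of_mem_stage hA hB (fun a => by
      rw [P.norm_pullback, NonUnitalStarAlgHom.norm_map π h.faithful]) N hN) hd
  have hstage : ∀ N, ∀ v ∈ stage (P.pullback.prod π)
      ((P.revInv.endo : C(P.Ext, ℂ) →ₗ[ℂ] C(P.Ext, ℂ)).prodMap (conjLinear U)) N,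
      ρ v.1 = v.2 := fun N v hv => hρ v (Set.mem_iUnion.2 ⟨N, hv⟩)
  have hρc : Continuous ρ := ρ.continuous_of_cstar
  have hσc : Continuous P.rev.endo := P.rev.endo.continuous_of_cstar
  have hτc : Continuous P.revInv.endo := P.revInv.endo.continuous_of_cstar
  refine ⟨ρ, hnorm, fun N a => hstage N _ ((mem_stage_iff N _).2 ⟨a, rfl⟩), fun f => ?_,
    fun f => ?_⟩
  · refine congrFun (Continuous.ext_on hd (hρc.comp hσc)
      (by fun_prop : Continuous fun f => U * ρ f * star U) ?_) f
    rintro _ ⟨v, hv, rfl⟩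
    obtain ⟨N, hN⟩ := Set.mem_iUnion.1 hv
    -- Compression lowers the stage by one, so the element is first regarded as a member of stage `N
    -- + 1`.
    have := hstage N _ (IsCovariantPair.compress_mem_stage hA hB N (stage_subset_succ _ _ _ hN))
    change ρ (P.rev.endo v.1) = conjLinear (star U) v.2 at this
    change ρ (P.rev.endo v.1) = U * ρ v.1 * star U
    rw [this, hstage N v hN, conjLinear_apply, star_star, mul_assoc]
  · refine congrFun (Continuous.ext_on hd (hρc.comp hτc)
      (by fun_prop : Continuous fun f => star U * ρ f * U) ?_) f
    rintro _ ⟨v, hv, rfl⟩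
    obtain ⟨N, hN⟩ := Set.mem_iUnion.1 hv
    -- With leading coefficient 0, the next stage contains `τ(v)` itself.
    have := hstage (N + 1) _ ⟨0, v, hN, rfl⟩
    rw [map_zero, zero_add] at this
    change ρ (P.revInv.endo v.1) = conjLinear U v.2 at this
    change ρ (P.revInv.endo v.1) = star U * ρ v.1 * U
    rw [this, hstage N v hN, conjLinear_apply, mul_assoc]

end Extension

/-! ### Identification of the range and the final assembly -/

/-- An isometric `*`-homomorphism that maps `[a₀, …, a_N, 0, …]` to `∑ U*ⁿπ(aₙ)Uⁿ` has the
coefficient algebra as its range. -/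
theorem range_eq_coefAlgebra {X : Type*} [TopologicalSpace X] {P : PartialDynSys X}
    [CompactSpace P.Ext] {H : Type*} [NormedAddCommGroup H] [InnerProductSpace ℂ H]
    [CompleteSpace H] {π : C(X, ℂ) →⋆ₙₐ[ℂ] (H →L[ℂ] H)} {U : H →L[ℂ] H}
    (ρ : C(P.Ext, ℂ) →⋆ₙₐ[ℂ] (H →L[ℂ] H))
    (hd : Dense {f | ∃ N a, f = P.bracket N a}) (hnorm : ∀ f, ‖ρ f‖ = ‖f‖)
    (hρ : ∀ N a, ρ (P.bracket N a) =
      ∑ n ∈ Finset.range (N + 1), star U ^ n * π (a n) * U ^ n) :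
    NonUnitalStarAlgHom.range ρ = coefAlgebra π U := by
  have hiso : Isometry ρ := AddMonoidHomClass.isometry_of_norm ρ hnorm
  apply le_antisymm
  · rintro _ ⟨f, rfl⟩
    have hcl : IsClosed {f | ρ f ∈ coefAlgebra π U} :=
      (NonUnitalStarSubalgebra.isClosed_topologicalClosure _).preimage hiso.continuous
    refine closure_minimal ?_ hcl (hd f)
    rintro _ ⟨N, a, rfl⟩
    change ρ _ ∈ coefAlgebra π U
    rw [hρ]
    refine sum_mem fun n _ => NonUnitalStarSubalgebra.le_topologicalClosure _
      (NonUnitalStarAlgebra.subset_adjoin ℂ _ (Set.mem_iUnion.2 ⟨n, a n, rfl⟩))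
  -- The range is closed, being an isometric image of a complete space, so it suffices to reach the
  -- generators; each is the image of a bracket with a single nonzero coefficient.
  · refine NonUnitalStarSubalgebra.topologicalClosure_minimal _
      (NonUnitalStarAlgebra.adjoin_le ?_) hiso.isClosedEmbedding.isClosed_range
    rintro _ ⟨_, ⟨n, rfl⟩, a, rfl⟩
    refine ⟨P.bracket n (Pi.single n a), (hρ _ _).trans ?_⟩
    rw [Finset.sum_eq_single n]
    · simp
    · intro m _ hm
      simp [Pi.single_eq_of_ne hm]
    · simp

theorem mainTheorem8 {X : Type*} [TopologicalSpace X] [CompactSpace X] [T2Space X]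
    (P : PartialDynSys X) (hP : IsOpen P.image)
    {H : Type*} [NormedAddCommGroup H] [InnerProductSpace ℂ H] [CompleteSpace H]
    (π : C(X, ℂ) →⋆ₙₐ[ℂ] (H →L[ℂ] H)) (U : H →L[ℂ] H) (hπ : IsCovFaithRep P π U) :
    CompactSpace P.Ext ∧ ∃ πbar : C(P.Ext, ℂ) ≃⋆ₐ[ℂ] coefAlgebra π U,
      -- `πbar` is given by `[a₀, …, a_N, 0, …] ↦ π(a₀) + U*π(a₁)U + ⋯ + U*ᴺπ(a_N)Uᴺ`
      (∀ (N : ℕ) (a : ℕ → C(X, ℂ)),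
        (πbar (P.bracket N a) : H →L[ℂ] H) =
          ∑ n ∈ Finset.range (N + 1), star U ^ n * π (a n) * U ^ n) ∧
      -- its inverse maps `∑ U*ⁿπ(aₙ)Uⁿ` to the function `(x₀, x₁, …) ↦ ∑ aₙ(xₙ)`
      (∀ (N : ℕ) (a : ℕ → C(X, ℂ)) (b : coefAlgebra π U),
        (b : H →L[ℂ] H) = ∑ n ∈ Finset.range (N + 1), star U ^ n * π (a n) * U ^ n →
          ∀ x : P.Ext, πbar.symm b x =
            ∑ n ∈ Finset.range (N + 1), Sum.elim (a n) (fun _ => 0) (x.1 n)) ∧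
      -- these formulas determine `πbar`
      (∀ ψ : C(P.Ext, ℂ) ≃⋆ₐ[ℂ] coefAlgebra π U,
        (∀ (N : ℕ) (a : ℕ → C(X, ℂ)),
          (ψ (P.bracket N a) : H →L[ℂ] H) =
            ∑ n ∈ Finset.range (N + 1), star U ^ n * π (a n) * U ^ n) → ψ = πbar) ∧
      -- `πbar` extends `π`, where `C(X)` is embedded into `C(X̃)` by `a ↦ a ∘ Φ`
      (∀ a : C(X, ℂ), (πbar (a.comp P.proj) : H →L[ℂ] H) = π a) ∧
      -- `(πbar, U, H)` is a covariant faithful representation of the reversible extension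
      (∃ ρ : C(P.Ext, ℂ) →⋆ₙₐ[ℂ] (H →L[ℂ] H),
        (∀ b, ρ b = (πbar b : H →L[ℂ] H)) ∧ IsCovFaithRep P.rev ρ U) ∧
      -- `πbar` intertwines the two endomorphisms with `U(·)U*` and `U*(·)U`
      (∀ b : C(P.Ext, ℂ), (πbar (P.rev.endo b) : H →L[ℂ] H) = U * (πbar b) * star U) ∧
      (∀ b : C(P.Ext, ℂ),
        (πbar (P.revInv.endo b) : H →L[ℂ] H) = star U * (πbar b) * U) := by
  have hK := P.isClopen_image hP
  have hcompact := P.compactSpace_ext hP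
  obtain ⟨ρ, hnorm, hρ, hσ, hτ⟩ := hπ.exists_extension hK
  have hd := dense_bracket hK hπ.toIsCovRep
  have hrange := range_eq_coefAlgebra ρ hd hnorm hρ
  have hinj : Function.Injective ρ := (AddMonoidHomClass.isometry_of_norm ρ hnorm).injective
  have hmem : ∀ f, ρ f ∈ coefAlgebra π U := fun f => hrange ▸ ⟨f, rfl⟩
  let ρ' : C(P.Ext, ℂ) →⋆ₙₐ[ℂ] coefAlgebra π U :=
    NonUnitalStarAlgHom.codRestrict ρ (coefAlgebra π U) hmem
  have hbij : Function.Bijective ρ' := by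
    refine ⟨fun f g h => hinj (congrArg Subtype.val h), ?_⟩
    rintro ⟨b, hb⟩
    rw [← hrange] at hb
    obtain ⟨f, rfl⟩ := hb
    exact ⟨f, rfl⟩
  have hpull : ∀ a, ρ (P.pullback a) = π a := fun a => by
    have := hρ 0 fun _ => a
    rw [P.bracket_zero] at this
    simpa using this
  refine ⟨hcompact, StarAlgEquiv.ofBijective ρ' hbij, hρ, fun N a b hb x => ?_, fun ψ hψ => ?_,
    hpull, ⟨ρ, fun _ => rfl, ⟨⟨?_, fun f => (hσ f).symm⟩, hinj⟩⟩, hσ, hτ⟩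
  · have : b = StarAlgEquiv.ofBijective ρ' hbij (P.bracket N a) :=
      Subtype.ext (hb.trans (hρ N a).symm)
    rw [this, StarAlgEquiv.symm_apply_apply]
    rfl
  -- Viewed as a `*`-homomorphism into `L(H)`, any competitor is automatically continuous, so
  -- agreement on the dense brackets suffices.
  · let ψ' : C(P.Ext, ℂ) →⋆ₙₐ[ℂ] (H →L[ℂ] H) :=
      (NonUnitalStarSubalgebraClass.subtype (coefAlgebra π U)).comp
        (ψ : C(P.Ext, ℂ) →⋆ₙₐ[ℂ] coefAlgebra π U)
    have hψ' : (ψ' : C(P.Ext, ℂ) → (H →L[ℂ] H)) = ρ := by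
      refine Continuous.ext_on hd (ψ'.continuous_of_cstar) (ρ.continuous_of_cstar) ?_
      rintro _ ⟨N, a, rfl⟩
      exact (hψ N a).trans (hρ N a).symm
    ext1 f
    exact Subtype.ext (congrFun hψ' f)
  -- The indicators of `Δ̃₁` and `Δ̃₋₁` are the pullbacks of those of `Δ₁` and `Δ₋₁`. Since the new
  -- representation extends `π`, the required initial and final spaces of `U` are unchanged.
  · have hU := hπ.isPartialIsometry
    rw [essSpace_vanishingOutside hK, essSpace_vanishingOutside P.isClopen_dom] at hU
    have hK' : IsClopen P.rev.image := P.rev_image ▸ P.revInv.isClopen_dom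
    rw [essSpace_vanishingOutside hK', essSpace_vanishingOutside P.rev.isClopen_dom]
    have h1 : clopenIndicator hK' = P.pullback (clopenIndicator hK) := by
      have himage : ∀ x, x ∈ P.rev.image ↔ P.proj x ∈ P.image := fun x => by
        rw [P.rev_image, P.revInv_dom, Set.mem_preimage]
      ext x
      rw [P.pullback_apply]
      by_cases hx : x ∈ P.rev.image
      · rw [clopenIndicator_of_mem _ hx, clopenIndicator_of_mem _ ((himage x).1 hx)]
      · rw [clopenIndicator_of_notMem _ hx, clopenIndicator_of_notMem _ fun h =>
          hx ((himage x).2 h)]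
    have h2 : clopenIndicator P.rev.isClopen_dom = P.pullback (clopenIndicator P.isClopen_dom) := by
      ext x
      rw [P.pullback_apply]
      by_cases hx : P.proj x ∈ P.dom
      · rw [clopenIndicator_of_mem _ (show x ∈ P.rev.dom from hx), clopenIndicator_of_mem _ hx]
      · rw [clopenIndicator_of_notMem _ (show x ∉ P.rev.dom from hx),
          clopenIndicator_of_notMem _ hx]
    rwa [h1, h2, hpull, hpull]
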